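/- All graphs are finite, simple and undirected. For a connected graph $G$ with distance $d$ and eccentricities $e(v)=\max_u d(u,v)$, the eccentricity matrix $\epsilon(G)$ has $(u,v)$ entry $d(u,v)$ if $d(u,v)=\min\{e(u),e(v)\}$ and $0$ otherwise; the $\epsilon$-spectrum of $G$ is the multiset of eigenvalues of $\epsilon(G)$. The central graph $C[G]$ is obtained from $G$ by subdividing every edge of $G$ by one new vertex and joining every two distinct vertices of $G$ that are not adjacent in $G$. The central vertex join $C[G_1]\dot\vee G_2$ is obtained from disjoint copies of $C[G_1]$ and $G_2$ by joining every original vertex of $G_1$ to every vertex of $G_2$. **Theorem.** For $i=1,2$ let $G_i$ be an $r_i$-regular graph with $p_i\ge 1$ vertices and $q_i$ edges, where $G_1$ is triangle-free and $r_1\ge 1$. Let $r_1,\lambda_2,\dots,\lambda_{p_1}$ and $r_2,\beta_2,\dots,\beta_{p_2}$ be the adjacency eigenvalues of $G_1$ and $G_2$, listed with multiplicity. Then the $\epsilon$-spectrum of $C[G_1]\dot\vee G_2$ consists, as a multiset, of 1. $3$ with multiplicity $q_1-p_1$; 2. $-2(1+\beta_j)$, $j=2,\dots,p_2$; 3. $-(2t_1+3(\lambda_i+r_1-1))$,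 $i=2,\dots,p_1$, where $t_1=\dfrac{-(3(r_1-1)+5\lambda_i)+\sqrt{(3(r_1-1)+5\lambda_i)^2+16(\lambda_i+r_1)}}{4}$; 4. $-(2t_2+3(\lambda_i+r_1-1))$, $i=2,\dots,p_1$, where $t_2=\dfrac{-(3(r_1-1)+5\lambda_i)-\sqrt{(3(r_1-1)+5\lambda_i)^2+16(\lambda_i+r_1)}}{4}$; 5. the three eigenvalues of the matrix $$\begin{pmatrix}2r_1&2(q_1-r_1)&0\\ 2(p_1-2)&3(q_1-2r_1+1)&2p_2\\ 0&2q_1&2(p_2-1-r_2)\end{pmatrix}.$$ If $q_1<p_1$ (which happens exactly when $r_1=1$), item 1 means that $p_1-q_1$ copies of the value $3$ are to be removed from the multiset given by items 2–5, which contains at least that many. -/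

import Mathlib

namespace EccentricitySpectra

/-- The eccentricity matrix of a finite graph: its `(u, v)` entry is the distance `d(u, v)` if
`d(u, v) = min (e(u)) (e(v))`, where `e` is the eccentricity, and `0` otherwise. The comparison is
made in `ℕ∞`; in a connected finite graph all distances and eccentricities are finite. -/
noncomputable def eccentricityMatrix {V : Type*} (G : SimpleGraph V) : Matrix V V ℝ :=
  open Classical in
  Matrix.of fun u v =>
    if G.edist u v = min (G.eccent u) (G.eccent v) then (G.dist u v : ℝ) else 0

theorem eccentricityMatrix_isHermitian {V : Type*} (G : SimpleGraph V) :
    (eccentricityMatrix G).IsHermitian := by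
  ext u v
  simp [eccentricityMatrix, SimpleGraph.edist_comm, SimpleGraph.dist_comm, min_comm]

/-- The real eigenvalues of a square matrix, each listed as often as its algebraic multiplicity. -/
noncomputable def realEigenvalues {n : Type*} [Fintype n] [DecidableEq n]
    (M : Matrix n n ℝ) : Multiset ℝ :=
  M.charpoly.roots

/-- The eigenvalues of the adjacency matrix, with multiplicity. -/
noncomputable def adjSpectrum {V : Type*} [Fintype V] [DecidableEq V]
    (G : SimpleGraph V) [DecidableRel G.Adj] : Multiset ℝ :=
  realEigenvalues (G.adjMatrix ℝ)

/-- The eigenvalues of the eccentricity matrix, with multiplicity. -/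
noncomputable def eccSpectrum {V : Type*} [Fintype V] [DecidableEq V]
    (G : SimpleGraph V) : Multiset ℝ :=
  realEigenvalues (eccentricityMatrix G)

/-- No eigenvalue is lost by working over `ℝ`. -/
theorem card_eccSpectrum {V : Type*} [Fintype V] [DecidableEq V] (G : SimpleGraph V) :
    (eccSpectrum G).card = Fintype.card V := by
  simp [eccSpectrum, realEigenvalues,
    (eccentricityMatrix_isHermitian G).roots_charpoly_eq_eigenvalues]

/-- The central graph of `G`: every edge of `G` is subdivided by one new vertex, and any two
distinct vertices of `G` that are not adjacent in `G` are joined. -/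
def centralGraph {V : Type*} (G : SimpleGraph V) : SimpleGraph (V ⊕ G.edgeSet) where
  Adj
    | .inl u, .inl v => u ≠ v ∧ ¬ G.Adj u v
    | .inl u, .inr e => u ∈ (e : Sym2 V)
    | .inr e, .inl u => u ∈ (e : Sym2 V)
    | .inr _, .inr _ => False
  symm := ⟨by
    rintro (u | e) (v | f) h
    · exact ⟨h.1.symm, fun h' => h.2 h'.symm⟩
    · exact h
    · exact h
    · exact h⟩
  loopless := ⟨by
    rintro (u | e) h
    · exact h.1 rfl
    · exact h⟩

/-- The central vertex join of `G₁` and `G₂`: the disjoint union of the central graph of `G₁` and of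
`G₂`, in which every original vertex of `G₁` is joined to every vertex of `G₂`. -/
def centralVertexJoin {V₁ V₂ : Type*} (G₁ : SimpleGraph V₁) (G₂ : SimpleGraph V₂) :
    SimpleGraph ((V₁ ⊕ G₁.edgeSet) ⊕ V₂) where
  Adj
    | .inl x, .inl y => (centralGraph G₁).Adj x y
    | .inr v, .inr w => G₂.Adj v w
    | .inl (.inl _), .inr _ => True
    | .inr _, .inl (.inl _) => True
    | .inl (.inr _), .inr _ => False
    | .inr _, .inl (.inr _) => False
  symm := ⟨by
    rintro (x | v) (y | w) h
    · exact (centralGraph G₁).adj_symm h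
    · rcases x with u | e
      · trivial
      · exact h.elim
    · rcases y with u | e
      · trivial
      · exact h.elim
    · exact G₂.adj_symm h⟩
  loopless := ⟨by
    rintro (x | v) h
    · exact (centralGraph G₁).irrefl h
    · exact G₂.irrefl h⟩

/-- The number `(-(3 (r - 1) + 5 l) + s √((3 (r - 1) + 5 l)² + 16 (l + r))) / 4`, where `s` is the
sign `1` or `-1`. -/
noncomputable def tValue (s r l : ℝ) : ℝ :=
  (-(3 * (r - 1) + 5 * l) + s * √((3 * (r - 1) + 5 * l) ^ 2 + 16 * (l + r))) / 4

/-- The `3 × 3` quotient matrix, in terms of the order `p₁`, the size `q₁` and the degree `r₁` of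
the first graph and the order `p₂` and the degree `r₂` of the second. -/
def quotientMatrix (p₁ q₁ r₁ p₂ r₂ : ℝ) : Matrix (Fin 3) (Fin 3) ℝ :=
  !![2 * r₁, 2 * (q₁ - r₁), 0;
     2 * (p₁ - 2), 3 * (q₁ - 2 * r₁ + 1), 2 * p₂;
     0, 2 * q₁, 2 * (p₂ - 1 - r₂)]

/-- The eigenvalues in the assertion apart from the explicit value `3`: those coming from the
eigenvalues `B` of the second graph, the two families coming from the eigenvalues `L` of the first
graph, and those of the quotient matrix. -/
noncomputable def remainingEigenvalues (L B : Multiset ℝ) (p₁ q₁ r₁ p₂ r₂ : ℝ) : Multiset ℝ :=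
  B.map (fun β => -2 * (1 + β))
    + L.map (fun l => -(2 * tValue 1 r₁ l + 3 * (l + r₁ - 1)))
    + L.map (fun l => -(2 * tValue (-1) r₁ l + 3 * (l + r₁ - 1)))
    + realEigenvalues (quotientMatrix p₁ q₁ r₁ p₂ r₂)

end EccentricitySpectra

/-! Original vertices and vertices of the second graph have eccentricity 2, and disjoint edges of
the first graph give subdivision vertices at distance 3. When two distinct edges meet, regularity
and triangle-freeness give each an edge disjoint from it, so both eccentricities are 3 and the entry
at distance 2 vanishes. Hence (`eccentricityMatrix_centralVertexJoin`) the eccentricity matrix is a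
block-constant matrix plus `reducedMatrix`, built from the adjacency matrices `A` and `A₂` and the
incidence matrix `R`.

The spectrum follows from `charpoly_add_mul_mul_charpoly`: if `M * U = U * Q`, then adding `U * K`
to `M` and `K * U` to `Q` changes both characteristic polynomials by the same factor. With `U` the
indicator of the three vertex classes, it replaces the factor of `reducedQuotient` by that of
`quotientMatrix`. With `U` built from `Rᵀ`, it turns the incidence part into a matrix with blocks
polynomial in `A`, since `R * Rᵀ = A + r • 1`. Each eigenvalue of `A` then leaves a 2×2 matrix,
triangularized by a shear with entry `tValue`. -/

namespace EccentricitySpectra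

open SimpleGraph

/-! ### Entries of an eccentricity matrix from distances. -/

section EccentricityMatrix

variable {V : Type*} {G : SimpleGraph V} {u v : V}

theorem edist_lt_two_of_adj_or_eq (h : G.Adj u v ∨ u = v) : G.edist u v < 2 :=
  (edist_le_one_iff_adj_or_eq.mpr h).trans_lt (by norm_num)

theorem edist_eq_two_of_common_neighbor {w : V} (hne : u ≠ v) (hadj : ¬ G.Adj u v)
    (h₁ : G.Adj u w) (h₂ : G.Adj w v) : G.edist u v = 2 :=
  edist_eq_two_iff.mpr ⟨hne, hadj, w, h₁, h₂.symm⟩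

theorem dist_eq_of_edist_eq {k : ℕ} (h : G.edist u v = k) : G.dist u v = k := by
  simp [SimpleGraph.dist, h]

theorem eccentricityMatrix_apply_eq_zero (h : G.edist u v < min (G.eccent u) (G.eccent v)) :
    eccentricityMatrix G u v = 0 := by
  simp [eccentricityMatrix, h.ne]

theorem eccentricityMatrix_apply_eq_natCast {k : ℕ} (h : G.edist u v = k)
    (h' : min (G.eccent u) (G.eccent v) = k) : eccentricityMatrix G u v = k := by
  simp [eccentricityMatrix, h, h', dist_eq_of_edist_eq h]

theorem eccentricityMatrix_comm : eccentricityMatrix G u v = eccentricityMatrix G v u := by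
  simpa using ((eccentricityMatrix_isHermitian G).apply u v).symm

end EccentricityMatrix

/-! ### Distances and eccentricities in the central vertex join. -/

section CentralVertexJoin

variable {V₁ V₂ : Type*} {G₁ : SimpleGraph V₁} {G₂ : SimpleGraph V₂}

@[simp] theorem centralVertexJoin_adj_vertex_vertex {u v : V₁} :
    (centralVertexJoin G₁ G₂).Adj (.inl (.inl u)) (.inl (.inl v)) ↔ u ≠ v ∧ ¬ G₁.Adj u v := .rfl

@[simp] theorem centralVertexJoin_adj_vertex_edge {u : V₁} {e : G₁.edgeSet} :
    (centralVertexJoin G₁ G₂).Adj (.inl (.inl u)) (.inl (.inr e)) ↔ u ∈ (e : Sym2 V₁) := .rfl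

@[simp] theorem centralVertexJoin_adj_edge_vertex {u : V₁} {e : G₁.edgeSet} :
    (centralVertexJoin G₁ G₂).Adj (.inl (.inr e)) (.inl (.inl u)) ↔ u ∈ (e : Sym2 V₁) := .rfl

@[simp] theorem centralVertexJoin_adj_edge_edge {e f : G₁.edgeSet} :
    ¬ (centralVertexJoin G₁ G₂).Adj (.inl (.inr e)) (.inl (.inr f)) := id

@[simp] theorem centralVertexJoin_adj_vertex_right {u : V₁} {w : V₂} :
    (centralVertexJoin G₁ G₂).Adj (.inl (.inl u)) (.inr w) := trivial

@[simp] theorem centralVertexJoin_adj_right_vertex {u : V₁} {w : V₂} :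
    (centralVertexJoin G₁ G₂).Adj (.inr w) (.inl (.inl u)) := trivial

@[simp] theorem centralVertexJoin_adj_edge_right {e : G₁.edgeSet} {w : V₂} :
    ¬ (centralVertexJoin G₁ G₂).Adj (.inl (.inr e)) (.inr w) := id

@[simp] theorem centralVertexJoin_adj_right_right {w x : V₂} :
    (centralVertexJoin G₁ G₂).Adj (.inr w) (.inr x) ↔ G₂.Adj w x := .rfl

/-- In a triangle-free graph every vertex off an edge is non-adjacent to an end of that edge. -/
theorem exists_mem_edge_not_adj (htri : G₁.CliqueFree 3) (e : G₁.edgeSet) (u : V₁) :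
    ∃ v ∈ (e : Sym2 V₁), ¬ G₁.Adj u v := by
  obtain ⟨e, he⟩ := e
  induction e with
  | _ a b =>
    by_contra! h
    classical
    exact htri {u, a, b} (is3Clique_triple_iff.mpr ⟨h a (by simp), h b (by simp), he⟩)

theorem edist_vertex_vertex {u v : V₁} (h : G₁.Adj u v) :
    (centralVertexJoin G₁ G₂).edist (.inl (.inl u)) (.inl (.inl v)) = 2 :=
  edist_eq_two_of_common_neighbor (w := .inl (.inr ⟨s(u, v), h⟩)) (by simpa using h.ne)
    (by simp [h]) (by simp) (by simp)

theorem edist_vertex_edge (htri : G₁.CliqueFree 3) {u : V₁} {e : G₁.edgeSet}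
    (h : u ∉ (e : Sym2 V₁)) :
    (centralVertexJoin G₁ G₂).edist (.inl (.inl u)) (.inl (.inr e)) = 2 := by
  obtain ⟨v, hv, huv⟩ := exists_mem_edge_not_adj htri e u
  refine edist_eq_two_of_common_neighbor (w := .inl (.inl v)) (by simp) (by simpa using h) ?_
    (by simpa using hv)
  simpa [huv] using fun h' : u = v => h (h' ▸ hv)

theorem edist_edge_right (e : G₁.edgeSet) (w : V₂) :
    (centralVertexJoin G₁ G₂).edist (.inl (.inr e)) (.inr w) = 2 :=
  edist_eq_two_of_common_neighbor (w := .inl (.inl (e : Sym2 V₁).out.1)) (by simp) (by simp)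
    (by simpa using Sym2.out_fst_mem _) (by simp)

theorem edist_right_right [Nonempty V₁] {w x : V₂} (hne : w ≠ x) (h : ¬ G₂.Adj w x) :
    (centralVertexJoin G₁ G₂).edist (.inr w) (.inr x) = 2 :=
  edist_eq_two_of_common_neighbor (w := .inl (.inl (Classical.arbitrary V₁))) (by simpa) (by simpa)
    (by simp) (by simp)

theorem edist_edge_edge_of_mem {u : V₁} {e f : G₁.edgeSet} (hne : e ≠ f) (he : u ∈ (e : Sym2 V₁))
    (hf : u ∈ (f : Sym2 V₁)) :
    (centralVertexJoin G₁ G₂).edist (.inl (.inr e)) (.inl (.inr f)) = 2 :=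
  edist_eq_two_of_common_neighbor (w := .inl (.inl u)) (by simpa) (by simp) (by simpa) (by simpa)

theorem edist_edge_edge_of_disjoint (htri : G₁.CliqueFree 3) {e f : G₁.edgeSet}
    (h : ∀ u ∈ (e : Sym2 V₁), u ∉ (f : Sym2 V₁)) :
    (centralVertexJoin G₁ G₂).edist (.inl (.inr e)) (.inl (.inr f)) = 3 := by
  have hmem := Sym2.out_fst_mem (e : Sym2 V₁)
  refine le_antisymm ?_ ?_
  · calc _ ≤ _ + _ := SimpleGraph.edist_triangle (v := .inl (.inl (e : Sym2 V₁).out.1))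
      _ = 1 + 2 := by
        rw [edist_vertex_edge htri (h _ hmem), edist_eq_one_iff_adj.mpr (by simpa using hmem)]
      _ = 3 := by norm_num
  -- A subdivision vertex is adjacent only to the two ends of its edge, so disjoint edges have no
  -- common neighbour.
  · rw [show (3 : ℕ∞) = 2 + 1 by norm_num]
    refine Order.add_one_le_of_lt (two_lt_edist_iff.mpr ⟨?_, by simp, ?_⟩)
    · rintro h'
      simp only [Sum.inl.injEq, Sum.inr.injEq] at h'
      exact h _ hmem (h' ▸ hmem)
    · ext x
      rcases x with (x | x) | x <;> simp [mem_commonNeighbors]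
      exact h x

theorem edist_edge_edge_le (htri : G₁.CliqueFree 3) (e f : G₁.edgeSet) :
    (centralVertexJoin G₁ G₂).edist (.inl (.inr e)) (.inl (.inr f)) ≤ 3 := by
  by_cases h : ∀ u ∈ (e : Sym2 V₁), u ∉ (f : Sym2 V₁)
  · exact (edist_edge_edge_of_disjoint htri h).le
  · push Not at h
    obtain ⟨u, he, hf⟩ := h
    rcases eq_or_ne e f with rfl | hne
    · simp
    · rw [edist_edge_edge_of_mem hne he hf]
      norm_num

theorem eccent_vertex (htri : G₁.CliqueFree 3) (hnbr : ∀ u, ∃ v, G₁.Adj u v) (u : V₁) :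
    (centralVertexJoin G₁ G₂).eccent (.inl (.inl u)) = 2 := by
  refine le_antisymm ((eccent_le_iff _ _).mpr ?_) ?_
  · rintro ((v | e) | w)
    · by_cases h : G₁.Adj u v
      · exact (edist_vertex_vertex h).le
      · exact (edist_lt_two_of_adj_or_eq (by simp [h]; tauto)).le
    · by_cases h : u ∈ (e : Sym2 V₁)
      · exact (edist_lt_two_of_adj_or_eq (.inl (by simpa))).le
      · exact (edist_vertex_edge htri h).le
    · exact (edist_lt_two_of_adj_or_eq (.inl (by simp))).le
  · obtain ⟨v, hv⟩ := hnbr u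
    exact (edist_vertex_vertex hv).ge.trans edist_le_eccent

theorem eccent_right [Nonempty V₁] (hnbr : ∀ u, ∃ v, G₁.Adj u v) (w : V₂) :
    (centralVertexJoin G₁ G₂).eccent (.inr w) = 2 := by
  refine le_antisymm ((eccent_le_iff _ _).mpr ?_) ?_
  · rintro ((v | e) | x)
    · exact (edist_lt_two_of_adj_or_eq (.inl (by simp))).le
    · rw [edist_comm]
      exact (edist_edge_right e w).le
    · by_cases h : G₂.Adj w x ∨ w = x
      · exact (edist_lt_two_of_adj_or_eq (by simpa using h)).le
      · push Not at h
        exact (edist_right_right h.2 h.1).le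
  · obtain ⟨v, hv⟩ := hnbr (Classical.arbitrary V₁)
    refine le_trans ?_ (edist_le_eccent (v := .inl (.inr ⟨s(_, v), hv⟩)))
    rw [edist_comm, edist_edge_right]

theorem two_le_eccent_edge [Nonempty V₂] (e : G₁.edgeSet) :
    2 ≤ (centralVertexJoin G₁ G₂).eccent (.inl (.inr e)) :=
  (edist_edge_right e (Classical.arbitrary V₂)).ge.trans edist_le_eccent

theorem eccent_edge_of_disjoint (htri : G₁.CliqueFree 3) {e f : G₁.edgeSet}
    (h : ∀ u ∈ (e : Sym2 V₁), u ∉ (f : Sym2 V₁)) :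
    (centralVertexJoin G₁ G₂).eccent (.inl (.inr e)) = 3 := by
  refine le_antisymm ((eccent_le_iff _ _).mpr ?_)
    ((edist_edge_edge_of_disjoint htri h).ge.trans edist_le_eccent)
  rintro ((v | f) | w)
  · rw [edist_comm]
    by_cases h : v ∈ (e : Sym2 V₁)
    · exact (edist_lt_two_of_adj_or_eq (.inl (by simpa))).le.trans (by norm_num)
    · exact (edist_vertex_edge htri h).le.trans (by norm_num)
  · exact edist_edge_edge_le htri e f
  · exact (edist_edge_right e w).le.trans (by norm_num)

/-- If two distinct edges of a regular triangle-free graph meet, then the first is disjoint from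
some edge. -/
theorem exists_disjoint_edge [Fintype V₁] [DecidableRel G₁.Adj] {r : ℕ} (htri : G₁.CliqueFree 3)
    (hreg : G₁.IsRegularOfDegree r) {u : V₁} {e f : G₁.edgeSet} (hne : e ≠ f)
    (he : u ∈ (e : Sym2 V₁)) (hf : u ∈ (f : Sym2 V₁)) :
    ∃ g : G₁.edgeSet, ∀ v ∈ (e : Sym2 V₁), v ∉ (g : Sym2 V₁) := by
  classical
  obtain ⟨e, he'⟩ := e
  obtain ⟨f, hf'⟩ := f
  obtain ⟨v, rfl⟩ := he
  obtain ⟨x, rfl⟩ := hf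
  have huv : G₁.Adj u v := he'
  have hux : G₁.Adj u x := hf'
  have hvx : v ≠ x := by
    rintro rfl
    exact hne rfl
  -- The end `u` has the two neighbours `v` and `x`; by regularity `x` has at least two neighbours
  -- as well, hence one other than `u`.
  have hdeg : 1 < (G₁.neighborFinset x).card := by
    rw [card_neighborFinset_eq_degree, hreg x, ← hreg u, ← card_neighborFinset_eq_degree]
    exact Finset.one_lt_card.mpr ⟨v, by simpa, x, by simpa, hvx⟩
  obtain ⟨y, hy, hyu⟩ := Finset.exists_mem_ne hdeg u
  have hxy : G₁.Adj x y := by simpa using hy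
  have hvy : v ≠ y := by
    rintro rfl
    exact htri {u, v, x} (is3Clique_triple_iff.mpr ⟨huv, hux, hxy.symm⟩)
  refine ⟨⟨s(x, y), hxy⟩, ?_⟩
  simp [hux.ne, hvx, hvy, hyu.symm]

end CentralVertexJoin

end EccentricitySpectra

namespace EccentricitySpectra

open Matrix Polynomial

/-! ### Characteristic polynomials under intertwined perturbations. -/

section CharpolyIntertwining

variable {R m n : Type*} [CommRing R] [Fintype m] [DecidableEq m] [Fintype n] [DecidableEq n]

theorem charpoly_conj {P P' : Matrix m m R} (h : P' * P = 1) (M : Matrix m m R) :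
    (P * M * P').charpoly = M.charpoly := by
  rw [charpoly_mul_comm, ← mul_assoc, h, one_mul]

/-- If `U` intertwines `M` and `Q`, then the same low-rank perturbation of both of them changes
their characteristic polynomials by the same factor. -/
theorem charpoly_add_mul_mul_charpoly (M : Matrix m m R) (Q : Matrix n n R) (U : Matrix m n R)
    (K : Matrix n m R) (h : M * U = U * Q) :
    (M + U * K).charpoly * Q.charpoly = M.charpoly * (Q + K * U).charpoly := by
  have hinv : fromBlocks 1 U 0 1 * fromBlocks 1 (-U) 0 1 = (1 : Matrix (m ⊕ n) (m ⊕ n) R) := by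
    simp [fromBlocks_multiply]
  have key := charpoly_conj hinv (fromBlocks (M + U * K) 0 K Q)
  rw [charpoly_fromBlocks_zero₁₂] at key
  -- The shear turns the blocks `M + U * K, 0, K, Q` into `M, M * U - U * Q, K, Q + K * U`, whose
  -- upper right block vanishes.
  rw [← key, ← charpoly_fromBlocks_zero₁₂ (M₂₁ := K)]
  simp [fromBlocks_multiply, h, add_comm]

/-- The characteristic polynomial of a matrix whose blocks, with respect to the partition into the
fibres of `c`, have constant row sums, up to a perturbation that is constant on each block. -/
theorem charpoly_add_submatrix_mul_charpoly (M : Matrix m m R) (Q C : Matrix n n R) (c : m → n)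
    (h : ∀ x j, ∑ y with c y = j, M x y = Q (c x) j) :
    (M + C.submatrix c c).charpoly * Q.charpoly
      = M.charpoly * (Q + C * diagonal fun j => (Finset.card {y | c y = j} : R)).charpoly := by
  -- The left factor is the indicator matrix of the fibres; constant row sums say that it
  -- intertwines `M` and `Q`.
  have hU : C.submatrix c c = (1 : Matrix n n R).submatrix c id * C.submatrix id c := by
    ext x y
    simp [Matrix.mul_apply, Matrix.one_apply]
  have hD : C * diagonal (fun j => (Finset.card {y | c y = j} : R))
      = C.submatrix id c * (1 : Matrix n n R).submatrix c id := by
    ext i j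
    simp [Matrix.mul_apply, Matrix.one_apply, diagonal_apply, Finset.sum_ite]
    rw [Finset.sum_congr rfl (g := fun _ => C i j) (by simp +contextual)]
    simp [mul_comm]
  rw [hU, hD]
  refine charpoly_add_mul_mul_charpoly M Q _ _ ?_
  ext x j
  simpa [Matrix.mul_apply, Matrix.one_apply, Finset.sum_ite] using h x j

theorem charpoly_smul_one (a : R) : (a • (1 : Matrix m m R)).charpoly = (X - C a) ^ Fintype.card m := by
  rw [smul_one_eq_diagonal, charpoly_diagonal]
  simp

end CharpolyIntertwining

/-! ### Real symmetric matrices. -/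

section Symmetric

variable {n : Type*} [Fintype n] [DecidableEq n]

theorem exists_conj_diagonal {A : Matrix n n ℝ} (hA : A.IsHermitian) :
    ∃ P P' : Matrix n n ℝ, P' * P = 1 ∧ P * P' = 1 ∧ P * A * P' = diagonal hA.eigenvalues := by
  refine ⟨star (hA.eigenvectorUnitary : Matrix n n ℝ), hA.eigenvectorUnitary, by simp, by simp, ?_⟩
  have := hA.conjStarAlgAut_star_eigenvectorUnitary
  rw [Unitary.conjStarAlgAut_star_apply] at this
  simpa [Function.comp_def] using! this

theorem charpoly_smul_one_add {A : Matrix n n ℝ} (hA : A.IsHermitian) (a : ℝ) :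
    (a • (1 + A)).charpoly = (A.charpoly.roots.map fun l => X - C (a * (1 + l))).prod := by
  obtain ⟨P, P', hP, hP', hA'⟩ := exists_conj_diagonal hA
  have : P * (a • (1 + A)) * P' = diagonal fun i => a * (1 + hA.eigenvalues i) := by
    rw [mul_smul_comm, smul_mul_assoc, mul_add, add_mul, hA', mul_one, hP']
    ext i j
    simp [Matrix.one_apply, diagonal_apply]
    split_ifs <;> simp
  rw [← charpoly_conj hP, this, charpoly_diagonal, hA.roots_charpoly_eq_eigenvalues]
  simp

/-- `R * Rᵀ` is positive semidefinite. This keeps the radicand in `tValue` nonnegative. -/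
theorem nonneg_of_mem_roots_charpoly_sub {m : Type*} [Fintype m] {A : Matrix n n ℝ} {R : Matrix n m ℝ}
    {r l : ℝ} (hR : R * Rᵀ = A + r • (1 : Matrix n n ℝ)) (hl : l ∈ A.charpoly.roots) : 0 ≤ l + r := by
  have hroot : A.charpoly.eval l = 0 := (mem_roots'.mp hl).2
  rw [eval_charpoly, ← exists_mulVec_eq_zero_iff] at hroot
  obtain ⟨v, hv, hvl⟩ := hroot
  have hAv : A *ᵥ v = l • v := by
    rw [sub_mulVec, sub_eq_zero] at hvl
    rw [← hvl]
    ext i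
    simp [Matrix.scalar_apply, mulVec_diagonal]
  have h1 : v ⬝ᵥ (R * Rᵀ) *ᵥ v = (l + r) * (v ⬝ᵥ v) := by
    rw [hR, add_mulVec, hAv, smul_mulVec, one_mulVec, ← add_smul]
    simp
  have h2 : v ⬝ᵥ (R * Rᵀ) *ᵥ v = (Rᵀ *ᵥ v) ⬝ᵥ (Rᵀ *ᵥ v) := by
    rw [← mulVec_mulVec, dotProduct_mulVec, mulVec_transpose]
  have h3 : 0 < v ⬝ᵥ v := by
    simpa using! dotProduct_star_self_pos_iff.mpr hv
  have h4 : 0 ≤ (Rᵀ *ᵥ v) ⬝ᵥ (Rᵀ *ᵥ v) := by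
    simpa using! dotProduct_star_self_nonneg (Rᵀ *ᵥ v)
  rw [← h2, h1] at h4
  exact nonneg_of_mul_nonneg_left h4 h3

end Symmetric

/-! ### Spectrum of the part coming from the first graph. -/

section FirstGraph

variable {n m : Type*} [Fintype n] [DecidableEq n] [Fintype m] [DecidableEq m]

/-- This equation is the condition for the shear with entry `tValue s r l` to kill the upper right
entry of the 2×2 matrix attached to `l`. -/
theorem tValue_quadratic {s r l : ℝ} (hs : s ^ 2 = 1) (h : 0 ≤ l + r) :
    2 * tValue s r l ^ 2 + (3 * (r - 1) + 5 * l) * tValue s r l = 2 * (l + r) := by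
  have hsq := Real.sq_sqrt (show 0 ≤ (3 * (r - 1) + 5 * l) ^ 2 + 16 * (l + r) by positivity)
  unfold tValue
  set w := √((3 * (r - 1) + 5 * l) ^ 2 + 16 * (l + r))
  linear_combination (1 / 8) * w ^ 2 * hs + (1 / 8) * hsq

theorem tValue_add_tValue_neg (r l : ℝ) :
    tValue 1 r l + tValue (-1) r l = -(3 * (r - 1) + 5 * l) / 2 := by
  unfold tValue
  ring

/-- The pair of linear factors of the characteristic polynomial that an adjacency eigenvalue `l` of
the first graph contributes. -/
noncomputable def eigenvalueFactor (r l : ℝ) : ℝ[X] :=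
  (X - C (-(2 * tValue 1 r l + 3 * (l + r - 1)))) * (X - C (-(2 * tValue (-1) r l + 3 * (l + r - 1))))

/-- All four blocks are polynomials in `A`, so an eigenbasis of `A` diagonalizes them together, and
one block shear `T` makes the result block triangular. -/
theorem charpoly_fromBlocks_adjacency {A : Matrix n n ℝ} (hA : A.IsHermitian) {r : ℝ}
    (hr : ∀ l ∈ A.charpoly.roots, 0 ≤ l + r) :
    (fromBlocks ((2 : ℝ) • A) ((-2 : ℝ) • (A + r • (1 : Matrix n n ℝ))) ((-2 : ℝ) • (1 : Matrix n n ℝ))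
        ((3 : ℝ) • (1 : Matrix n n ℝ) + (-3 : ℝ) • (A + r • (1 : Matrix n n ℝ)))).charpoly
      = (A.charpoly.roots.map (eigenvalueFactor r)).prod := by
  obtain ⟨P, P', hP, hP', hA'⟩ := exists_conj_diagonal hA
  set d := hA.eigenvalues
  have hd : ∀ i, 0 ≤ d i + r := fun i => hr _ (by simp [hA.roots_charpoly_eq_eigenvalues, d])
  let T : Matrix n n ℝ := diagonal fun i => tValue 1 r (d i)
  have hT : (fromBlocks 1 T 0 1 : Matrix (n ⊕ n) (n ⊕ n) ℝ) * fromBlocks 1 (-T) 0 1 = 1 := by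
    simp [fromBlocks_multiply]
  have hPP : fromBlocks P' 0 0 P' * fromBlocks P 0 0 P = (1 : Matrix (n ⊕ n) (n ⊕ n) ℝ) := by
    simp [fromBlocks_multiply, hP]
  have hB : P * (A + r • (1 : Matrix n n ℝ)) * P' = diagonal fun i => d i + r := by
    rw [mul_add, add_mul, hA', mul_smul_comm, smul_mul_assoc, mul_one, hP', smul_one_eq_diagonal,
      diagonal_add]
  have hdiag : fromBlocks P 0 0 P * fromBlocks ((2 : ℝ) • A)
      ((-2 : ℝ) • (A + r • (1 : Matrix n n ℝ))) ((-2 : ℝ) • (1 : Matrix n n ℝ))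
      ((3 : ℝ) • (1 : Matrix n n ℝ) + (-3 : ℝ) • (A + r • (1 : Matrix n n ℝ)))
      * fromBlocks P' 0 0 P'
      = fromBlocks (diagonal fun i => 2 * d i) (diagonal fun i => -2 * (d i + r))
        (diagonal fun _ => -2) (diagonal fun i => 3 - 3 * (d i + r)) := by
    simp only [fromBlocks_multiply, mul_zero, zero_mul, add_zero, zero_add]
    rw [mul_add _ ((3 : ℝ) • (1 : Matrix n n ℝ)), add_mul]
    simp only [mul_smul_comm, smul_mul_assoc, hB, hA', mul_one, hP']
    congr 1 <;> ext i j <;> rcases eq_or_ne i j with rfl | h <;> simp [*]; ring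
  have htri : fromBlocks 1 (-T) 0 1 * fromBlocks (diagonal fun i => 2 * d i)
      (diagonal fun i => -2 * (d i + r)) (diagonal fun _ => -2)
      (diagonal fun i => 3 - 3 * (d i + r)) * fromBlocks 1 T 0 1
      = fromBlocks (diagonal fun i => -(2 * tValue (-1) r (d i) + 3 * (d i + r - 1))) 0
        (diagonal fun _ => -2) (diagonal fun i => -(2 * tValue 1 r (d i) + 3 * (d i + r - 1))) := by
    simp only [fromBlocks_multiply, one_mul, mul_one, mul_zero, zero_mul, add_zero, zero_add, T,
      diagonal_neg, diagonal_mul_diagonal, diagonal_add]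
    rw [← diagonal_zero]
    congr 2 <;> funext i
    · linear_combination 2 * tValue_add_tValue_neg r (d i)
    · linear_combination tValue_quadratic (s := 1) (by norm_num) (hd i)
    · ring
  rw [← charpoly_conj hPP, hdiag, ← charpoly_conj hT, htri, charpoly_fromBlocks_zero₁₂,
    charpoly_diagonal, charpoly_diagonal, ← Finset.prod_mul_distrib,
    hA.roots_charpoly_eq_eigenvalues]
  rw [Multiset.map_map]
  refine Finset.prod_congr rfl fun i _ => ?_
  simp only [Function.comp_apply, RCLike.ofReal_real_eq_id, id_eq]
  exact mul_comm _ _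

/-- The characteristic polynomial of the part of the eccentricity matrix that is built from the
incidence matrix `R` of the first graph. -/
theorem charpoly_fromBlocks_incidence {A : Matrix n n ℝ} (hA : A.IsHermitian) {R : Matrix n m ℝ}
    {r : ℝ} (hR : R * Rᵀ = A + r • (1 : Matrix n n ℝ)) :
    (fromBlocks ((2 : ℝ) • A) ((-2 : ℝ) • R) ((-2 : ℝ) • Rᵀ)
        ((3 : ℝ) • (1 : Matrix m m ℝ) + (-3 : ℝ) • (Rᵀ * R))).charpoly * (X - C 3) ^ Fintype.card n
      = (X - C 3) ^ Fintype.card m * (A.charpoly.roots.map (eigenvalueFactor r)).prod := by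
  -- Scalar matrices are intertwined by any `U`. Here `K` is chosen so that `3 • 1 + U * K` is the
  -- incidence matrix form, while in `K * U` only the product `R * Rᵀ` survives.
  have key := charpoly_add_mul_mul_charpoly ((3 : ℝ) • (1 : Matrix (n ⊕ m) (n ⊕ m) ℝ))
    ((3 : ℝ) • (1 : Matrix (n ⊕ n) (n ⊕ n) ℝ)) (fromBlocks 1 0 0 Rᵀ)
    (fromBlocks ((2 : ℝ) • A - (3 : ℝ) • (1 : Matrix n n ℝ)) ((-2 : ℝ) • R)
      ((-2 : ℝ) • (1 : Matrix n n ℝ)) ((-3 : ℝ) • R)) (by simp)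
  rw [charpoly_smul_one, charpoly_smul_one] at key
  simp only [← fromBlocks_one, fromBlocks_smul, fromBlocks_multiply, fromBlocks_add,
    Matrix.one_mul, Matrix.mul_one, Matrix.mul_zero, Matrix.zero_mul, add_zero, zero_add, smul_zero,
    Matrix.mul_smul, Matrix.smul_mul, hR, add_sub_cancel] at key
  rw [charpoly_fromBlocks_adjacency hA fun l hl => nonneg_of_mem_roots_charpoly_sub hR hl] at key
  have hne : (X - C (3 : ℝ)) ^ Fintype.card n ≠ 0 := pow_ne_zero _ (X_sub_C_ne_zero _)
  refine mul_right_cancel₀ hne ?_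
  simp only [Fintype.card_sum, pow_add] at key
  rw [← mul_assoc] at key
  rw [key]
  ring

end FirstGraph

end EccentricitySpectra

namespace EccentricitySpectra

open SimpleGraph Matrix Polynomial

/-! ### The vertex-edge incidence matrix of a regular graph. -/

section Incidence

variable {V : Type*} [DecidableEq V] {G : SimpleGraph V}

/-- The incidence matrix with columns indexed by the edges only. -/
def edgeIncidence (G : SimpleGraph V) : Matrix V G.edgeSet ℝ :=
  Matrix.of fun u e => if u ∈ (e : Sym2 V) then 1 else 0

theorem edgeIncidence_apply (u : V) (e : G.edgeSet) :
    edgeIncidence G u e = if u ∈ (e : Sym2 V) then 1 else 0 := rfl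

variable [Fintype V] [DecidableRel G.Adj]

theorem edgeIncidence_eq_incMatrix (u : V) (e : G.edgeSet) :
    edgeIncidence G u e = G.incMatrix ℝ u e := by
  simp [edgeIncidence_apply, incMatrix_apply', incidenceSet]

theorem sum_edgeSet_incMatrix (f : Sym2 V → ℝ) (u : V) :
    ∑ e : G.edgeSet, G.incMatrix ℝ u e * f e = ∑ e, G.incMatrix ℝ u e * f e := by
  refine Fintype.sum_of_injective (fun e : G.edgeSet => (e : Sym2 V)) Subtype.val_injective _ _
    (fun e he => ?_) fun _ => rfl
  rw [incMatrix_of_notMem_incidenceSet _ fun h => he ⟨⟨e, h.1⟩, rfl⟩, zero_mul]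

theorem edgeIncidence_mul_transpose {r : ℕ} (hreg : G.IsRegularOfDegree r) :
    edgeIncidence G * (edgeIncidence G)ᵀ = G.adjMatrix ℝ + (r : ℝ) • (1 : Matrix V V ℝ) := by
  have key := G.incMatrix_mul_transpose (R := ℝ)
  ext u v
  have h := congrFun₂ key u v
  simp only [Matrix.mul_apply, transpose_apply] at h ⊢
  simp only [edgeIncidence_eq_incMatrix]
  rw [sum_edgeSet_incMatrix, h]
  rcases eq_or_ne u v with rfl | huv
  · simp [hreg u]
  · simp [huv, adjMatrix_apply]

theorem sum_edgeIncidence_row {r : ℕ} (hreg : G.IsRegularOfDegree r) (u : V) :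
    ∑ e, edgeIncidence G u e = r := by
  have h := sum_edgeSet_incMatrix (G := G) 1 u
  simp only [Pi.one_apply, mul_one, sum_incMatrix_apply, hreg u] at h
  simpa only [edgeIncidence_eq_incMatrix] using h

theorem sum_edgeIncidence_mul (f : V → ℝ) {a b : V} (h : G.Adj a b) :
    ∑ u, edgeIncidence G u ⟨s(a, b), h⟩ * f u = f a + f b := by
  simp only [edgeIncidence_apply, Sym2.mem_iff, ite_mul, one_mul, zero_mul]
  rw [← Finset.sum_filter, show Finset.univ.filter (fun u => u = a ∨ u = b) = {a, b} by ext; simp,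
    Finset.sum_pair h.ne]

theorem sum_edgeIncidence_col (e : G.edgeSet) : ∑ u, edgeIncidence G u e = 2 := by
  obtain ⟨⟨a, b⟩, h⟩ := e
  have := sum_edgeIncidence_mul (G := G) 1 h
  norm_num at this
  exact this

/-- An entry counts common ends, and distinct edges of a simple graph share at most one. -/
theorem transpose_edgeIncidence_mul_apply (e f : G.edgeSet) :
    ((edgeIncidence G)ᵀ * edgeIncidence G) e f
      = if e = f then 2 else if ∃ u ∈ (e : Sym2 V), u ∈ (f : Sym2 V) then 1 else 0 := by
  obtain ⟨⟨a, b⟩, h⟩ := e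
  have hsum := sum_edgeIncidence_mul (G := G) (fun u => edgeIncidence G u f) h
  simp only [Matrix.mul_apply, transpose_apply]
  refine hsum.trans ?_
  split_ifs with hef hu
  · subst hef
    norm_num [edgeIncidence_apply]
  · have hab : ¬ (a ∈ (f : Sym2 V) ∧ b ∈ (f : Sym2 V)) := fun hf =>
      hef (Subtype.ext ((Sym2.mem_and_mem_iff (G.ne_of_adj h)).mp hf).symm)
    obtain ⟨u, hu, huf⟩ := hu
    rcases Sym2.mem_iff.mp hu with rfl | rfl
    · simpa [edgeIncidence_apply, huf] using fun h' => hab ⟨huf, h'⟩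
    · simpa [edgeIncidence_apply, huf] using fun h' => hab ⟨h', huf⟩
  · push Not at hu
    simp [edgeIncidence_apply, hu a (Sym2.mem_mk_left _ _), hu b (Sym2.mem_mk_right _ _)]

theorem sum_transpose_edgeIncidence_mul {r : ℕ} (hreg : G.IsRegularOfDegree r) (e : G.edgeSet) :
    ∑ f, ((edgeIncidence G)ᵀ * edgeIncidence G) e f = 2 * r := by
  simp only [Matrix.mul_apply, transpose_apply]
  rw [Finset.sum_comm]
  simp only [← Finset.mul_sum, sum_edgeIncidence_row hreg, ← Finset.sum_mul, sum_edgeIncidence_col]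

theorem sum_adjMatrix_row {r : ℕ} (hreg : G.IsRegularOfDegree r) (u : V) :
    ∑ v, G.adjMatrix ℝ u v = r := by
  simp [adjMatrix_apply, ← hreg u, ← card_neighborFinset_eq_degree, neighborFinset_eq_filter]

end Incidence

/-! ### The eccentricity matrix of the join and its spectrum. -/

section EccentricityOfJoin

variable {V₁ V₂ : Type*} [Fintype V₁] [DecidableEq V₁] [Fintype V₂] [DecidableEq V₂]
  {G₁ : SimpleGraph V₁} [DecidableRel G₁.Adj] {G₂ : SimpleGraph V₂} [DecidableRel G₂.Adj]

/-- The class of a vertex of the central vertex join in its partition into original vertices of the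
first graph, edges of the first graph and vertices of the second graph. -/
def vertexClass (G₁ : SimpleGraph V₁) (V₂ : Type*) : (V₁ ⊕ G₁.edgeSet) ⊕ V₂ → Fin 3 :=
  Sum.elim (Sum.elim (fun _ => 0) fun _ => 1) fun _ => 2

/-- The values by which the blocks of the eccentricity matrix exceed those of `reducedMatrix`. -/
def blockConstants : Matrix (Fin 3) (Fin 3) ℝ :=
  !![0, 2, 0;
     2, 3, 2;
     0, 2, 2]

/-- The eccentricity matrix of the central vertex join with a constant subtracted from each
block. -/
noncomputable def reducedMatrix (G₁ : SimpleGraph V₁) [DecidableRel G₁.Adj] (G₂ : SimpleGraph V₂)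
    [DecidableRel G₂.Adj] : Matrix ((V₁ ⊕ G₁.edgeSet) ⊕ V₂) ((V₁ ⊕ G₁.edgeSet) ⊕ V₂) ℝ :=
  fromBlocks
    (fromBlocks ((2 : ℝ) • G₁.adjMatrix ℝ) ((-2 : ℝ) • edgeIncidence G₁)
      ((-2 : ℝ) • (edgeIncidence G₁)ᵀ) ((3 : ℝ) • (1 : Matrix G₁.edgeSet G₁.edgeSet ℝ) +
        (-3 : ℝ) • ((edgeIncidence G₁)ᵀ * edgeIncidence G₁)))
    0 0 ((-2 : ℝ) • (1 + G₂.adjMatrix ℝ))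

/-- The matrix of block row sums of `reducedMatrix`. -/
def reducedQuotient (r₁ r₂ : ℝ) : Matrix (Fin 3) (Fin 3) ℝ :=
  !![2 * r₁, -2 * r₁, 0;
     -4, 3 - 6 * r₁, 0;
     0, 0, -2 * (1 + r₂)]

theorem eccentricityMatrix_centralVertexJoin [Nonempty V₁] [Nonempty V₂] (htri : G₁.CliqueFree 3)
    {r : ℕ} (hr : 1 ≤ r) (hreg : G₁.IsRegularOfDegree r) :
    eccentricityMatrix (centralVertexJoin G₁ G₂)
      = reducedMatrix G₁ G₂ + blockConstants.submatrix (vertexClass G₁ V₂) (vertexClass G₁ V₂) := by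
  have hnbr : ∀ u, ∃ v, G₁.Adj u v := fun u =>
    (G₁.degree_pos_iff_exists_adj u).mp (by rw [hreg u]; omega)
  have hV := eccent_vertex (G₂ := G₂) htri hnbr
  have hW := eccent_right (G₂ := G₂) hnbr
  have hE := two_le_eccent_edge (V₂ := V₂) (G₁ := G₁) (G₂ := G₂)
  have h2 : ∀ x, 2 ≤ (centralVertexJoin G₁ G₂).eccent x := by
    rintro ((u | e) | w)
    exacts [(hV u).ge, hE e, (hW w).ge]
  have hzero : ∀ x y, (centralVertexJoin G₁ G₂).Adj x y ∨ x = y →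
      eccentricityMatrix (centralVertexJoin G₁ G₂) x y = 0 := fun x y h =>
    eccentricityMatrix_apply_eq_zero ((edist_lt_two_of_adj_or_eq h).trans_le (le_min (h2 x) (h2 y)))
  have htwo : ∀ x y, (centralVertexJoin G₁ G₂).edist x y = 2 →
      (centralVertexJoin G₁ G₂).eccent x = 2 →
      eccentricityMatrix (centralVertexJoin G₁ G₂) x y = 2 := fun x y h hx =>
    mod_cast eccentricityMatrix_apply_eq_natCast (k := 2) (mod_cast h)
      (by rw [hx]; exact min_eq_left (h2 y))
  have hVE : ∀ u e, eccentricityMatrix (centralVertexJoin G₁ G₂) (.inl (.inl u)) (.inl (.inr e))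
      = 2 - 2 * edgeIncidence G₁ u e := by
    intro u e
    by_cases h : u ∈ (e : Sym2 V₁)
    · rw [hzero _ _ (.inl (by simpa))]
      simp [edgeIncidence_apply, h]
    · rw [htwo _ _ (edist_vertex_edge htri h) (hV u)]
      simp [edgeIncidence_apply, h]
  have hVW : ∀ u w, eccentricityMatrix (centralVertexJoin G₁ G₂) (.inl (.inl u)) (.inr w) = 0 :=
    fun u w => hzero _ _ (.inl (by simp))
  have hWE : ∀ w e, eccentricityMatrix (centralVertexJoin G₁ G₂) (.inr w) (.inl (.inr e)) = 2 :=
    fun w e => htwo _ _ (by rw [edist_comm, edist_edge_right]) (hW w)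
  ext ((u | e) | w) ((v | f) | x)
  · by_cases h : G₁.Adj u v
    · rw [htwo _ _ (edist_vertex_vertex h) (hV u)]
      simp [reducedMatrix, vertexClass, blockConstants, h]
    · rw [hzero _ _ (by simp [h]; tauto)]
      simp [reducedMatrix, vertexClass, blockConstants, h]
  · rw [hVE]
    simp [reducedMatrix, vertexClass, blockConstants]
    ring
  · rw [hVW]
    simp [reducedMatrix, vertexClass, blockConstants]
  · rw [eccentricityMatrix_comm, hVE]
    simp [reducedMatrix, vertexClass, blockConstants]
    ring
  · have hR : (reducedMatrix G₁ G₂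
        + blockConstants.submatrix (vertexClass G₁ V₂) (vertexClass G₁ V₂))
        (.inl (.inr e)) (.inl (.inr f)) = 3 * (1 : Matrix G₁.edgeSet G₁.edgeSet ℝ) e f
          + -3 * ((edgeIncidence G₁)ᵀ * edgeIncidence G₁) e f + 3 := by
      simp [reducedMatrix, vertexClass, blockConstants]
    rw [hR, transpose_edgeIncidence_mul_apply]
    split_ifs with hef hu
    · subst hef
      rw [hzero _ _ (.inr rfl)]
      norm_num
    · obtain ⟨u, hue, huf⟩ := hu
      -- Both eccentricities must be 3 for the minimum to exceed the distance 2, so each of `e` and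
      -- `f` needs its own disjoint edge.
      obtain ⟨g, hg⟩ := exists_disjoint_edge htri hreg hef hue huf
      obtain ⟨g', hg'⟩ := exists_disjoint_edge htri hreg (Ne.symm hef) huf hue
      rw [eccentricityMatrix_apply_eq_zero]
      · simp [hef]
      · rw [eccent_edge_of_disjoint htri hg, eccent_edge_of_disjoint htri hg',
          edist_edge_edge_of_mem hef hue huf]
        norm_num
    · push Not at hu
      have h3 := edist_edge_edge_of_disjoint (G₂ := G₂) htri hu
      rw [eccentricityMatrix_apply_eq_natCast (k := 3) (mod_cast h3)]
      · simp [hef]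
      · rw [eccent_edge_of_disjoint htri hu,
          eccent_edge_of_disjoint htri fun v hvf hve => hu v hve hvf]
        norm_num
  · rw [eccentricityMatrix_comm, hWE]
    simp [reducedMatrix, vertexClass, blockConstants]
  · rw [eccentricityMatrix_comm, hVW]
    simp [reducedMatrix, vertexClass, blockConstants]
  · rw [hWE]
    simp [reducedMatrix, vertexClass, blockConstants]
  · by_cases h : G₂.Adj w x ∨ w = x
    · rw [hzero _ _ (by simpa using h)]
      rcases h with h | rfl
      · simp [reducedMatrix, vertexClass, blockConstants, h, h.ne]
      · simp [reducedMatrix, vertexClass, blockConstants]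
    · push Not at h
      rw [htwo _ _ (edist_right_right h.2 h.1) (hW w)]
      simp [reducedMatrix, vertexClass, blockConstants, h]

theorem sum_filter_vertexClass (f : (V₁ ⊕ G₁.edgeSet) ⊕ V₂ → ℝ) (j : Fin 3) :
    ∑ y with vertexClass G₁ V₂ y = j, f y
      = ![∑ u, f (.inl (.inl u)), ∑ e, f (.inl (.inr e)), ∑ w, f (.inr w)] j := by
  rw [Finset.sum_filter]
  fin_cases j <;> simp [vertexClass]

theorem reducedMatrix_block_row_sum {r₁ r₂ : ℕ} (hG₁ : G₁.IsRegularOfDegree r₁)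
    (hG₂ : G₂.IsRegularOfDegree r₂) (x : (V₁ ⊕ G₁.edgeSet) ⊕ V₂) (j : Fin 3) :
    ∑ y with vertexClass G₁ V₂ y = j, reducedMatrix G₁ G₂ x y
      = reducedQuotient r₁ r₂ (vertexClass G₁ V₂ x) j := by
  rw [sum_filter_vertexClass]
  rcases x with (u | e) | w <;> fin_cases j <;>
    simp only [reducedMatrix, reducedQuotient, vertexClass, fromBlocks_apply₁₁, fromBlocks_apply₁₂,
      fromBlocks_apply₂₁, fromBlocks_apply₂₂, Sum.elim_inl, Sum.elim_inr, Fin.zero_eta, Fin.mk_one,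
      Fin.reduceFinMk, Matrix.add_apply, Matrix.smul_apply, transpose_apply, Matrix.zero_apply,
      smul_eq_mul, Finset.sum_add_distrib, ← Finset.mul_sum, sum_adjMatrix_row hG₁,
      sum_adjMatrix_row hG₂, sum_edgeIncidence_row hG₁, sum_edgeIncidence_col,
      sum_transpose_edgeIncidence_mul hG₁, Finset.sum_const_zero, of_apply, cons_val,
      Matrix.one_apply, Finset.sum_ite_eq, Finset.mem_univ, if_true] <;> ring

theorem reducedQuotient_add_blockConstants_mul (r₁ r₂ : ℝ) :
    reducedQuotient r₁ r₂ + blockConstants * diagonal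
        (fun j => (Finset.card {y | vertexClass G₁ V₂ y = j} : ℝ))
      = quotientMatrix (Fintype.card V₁) (Fintype.card G₁.edgeSet) r₁ (Fintype.card V₂) r₂ := by
  have hcard : ∀ j, (Finset.card {y | vertexClass G₁ V₂ y = j} : ℝ)
      = ![(Fintype.card V₁ : ℝ), Fintype.card G₁.edgeSet, Fintype.card V₂] j := by
    intro j
    have := sum_filter_vertexClass (G₁ := G₁) (V₂ := V₂) (fun _ => 1) j
    simpa using this
  simp only [hcard]
  ext i j
  rw [Matrix.add_apply, mul_diagonal]
  fin_cases i <;> fin_cases j <;> simp [reducedQuotient, blockConstants, quotientMatrix] <;> ring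

/-- On vectors constant on each class the adjacency matrices act as `r₁` and `r₂`. These are the
factors that the perturbation replaces, which is why `r₁` and `r₂` are absent from `L` and `B`. -/
theorem charpoly_reducedQuotient {r₁ : ℝ} (r₂ : ℝ) (hr : 0 ≤ r₁) :
    (reducedQuotient r₁ r₂).charpoly = eigenvalueFactor r₁ r₁ * (X - C (-2 * (1 + r₂))) := by
  have hs : 2 * tValue 1 r₁ r₁ + 2 * tValue (-1) r₁ r₁ = 3 - 8 * r₁ := by
    linear_combination 2 * tValue_add_tValue_neg r₁ r₁
  have hq := tValue_quadratic (s := 1) (r := r₁) (l := r₁) (by norm_num) (by linarith)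
  replace hs := congrArg (C : ℝ → ℝ[X]) hs
  replace hq := congrArg (C : ℝ → ℝ[X]) hq
  rw [Matrix.charpoly, det_fin_three, eigenvalueFactor]
  simp [reducedQuotient] at hs hq ⊢
  have hC : C (2 : ℝ) = 2 ∧ C (3 : ℝ) = 3 ∧ C (4 : ℝ) = 4 ∧ C (5 : ℝ) = 5 ∧ C (6 : ℝ) = 6
      ∧ C (8 : ℝ) = 8 := ⟨rfl, rfl, rfl, rfl, rfl, rfl⟩
  obtain ⟨h2, h3, h4, h5, h6, h8⟩ := hC
  rw [h2, h3, h8] at hs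
  rw [h2, h3, h5] at hq
  rw [h2, h3, h4, h6]
  -- The sum relation `hs` eliminates the second root, then `hq` eliminates the square of the first.
  linear_combination (X + 2 * (1 + C r₂)) *
    (2 * hq - (X + 2 * C (tValue 1 r₁ r₁) + 6 * C r₁ - 3) * hs)

theorem charpoly_reducedMatrix {r : ℕ} (hreg : G₁.IsRegularOfDegree r) :
    (reducedMatrix G₁ G₂).charpoly * (X - C 3) ^ Fintype.card V₁
      = (X - C 3) ^ Fintype.card G₁.edgeSet * ((adjSpectrum G₁).map (eigenvalueFactor r)).prod
        * ((adjSpectrum G₂).map fun β => X - C (-2 * (1 + β))).prod := by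
  have h₁ : (G₁.adjMatrix ℝ).IsHermitian := by
    simp [Matrix.IsHermitian]
  have h₂ : (G₂.adjMatrix ℝ).IsHermitian := by
    simp [Matrix.IsHermitian]
  rw [reducedMatrix, charpoly_fromBlocks_zero₁₂, mul_right_comm,
    charpoly_fromBlocks_incidence h₁ (edgeIncidence_mul_transpose hreg), charpoly_smul_one_add h₂]
  rfl

theorem nonempty_of_adjSpectrum_eq_cons {V : Type*} [Fintype V] [DecidableEq V] {G : SimpleGraph V}
    [DecidableRel G.Adj] {a : ℝ} {s : Multiset ℝ} (h : adjSpectrum G = a ::ₘ s) : Nonempty V := by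
  by_contra hV
  rw [not_nonempty_iff] at hV
  simp [adjSpectrum, realEigenvalues, charpoly_isEmpty] at h

theorem eigenvalueFactor_ne_zero (r l : ℝ) : eigenvalueFactor r l ≠ 0 :=
  mul_ne_zero (X_sub_C_ne_zero _) (X_sub_C_ne_zero _)

theorem roots_prod_map_X_sub_C {ι : Type*} (s : Multiset ι) (f : ι → ℝ) :
    (s.map fun i => X - C (f i)).prod.roots = s.map f := by
  simpa [Multiset.map_map, Function.comp_def] using roots_multiset_prod_X_sub_C (s.map f)

theorem prod_map_X_sub_C_ne_zero {ι : Type*} (s : Multiset ι) (f : ι → ℝ) :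
    (s.map fun i => X - C (f i)).prod ≠ 0 :=
  (monic_multiset_prod_of_monic s _ fun _ _ => monic_X_sub_C _).ne_zero

/-- Keeping the powers of `X - C 3` on both sides avoids a negative exponent when there are fewer
edges than vertices. -/
theorem charpoly_eccentricityMatrix_centralVertexJoin (htri : G₁.CliqueFree 3) {r₁ r₂ : ℕ}
    (hr₁ : 1 ≤ r₁) (hG₁ : G₁.IsRegularOfDegree r₁) (hG₂ : G₂.IsRegularOfDegree r₂)
    {L B : Multiset ℝ} (hL : adjSpectrum G₁ = (r₁ : ℝ) ::ₘ L) (hB : adjSpectrum G₂ = (r₂ : ℝ) ::ₘ B) :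
    (eccentricityMatrix (centralVertexJoin G₁ G₂)).charpoly * (X - C 3) ^ Fintype.card V₁
      = (X - C 3) ^ Fintype.card G₁.edgeSet * (L.map (eigenvalueFactor r₁)).prod
        * (B.map fun β => X - C (-2 * (1 + β))).prod
        * (quotientMatrix (Fintype.card V₁) (Fintype.card G₁.edgeSet) r₁
            (Fintype.card V₂) r₂).charpoly := by
  have := nonempty_of_adjSpectrum_eq_cons hL
  have := nonempty_of_adjSpectrum_eq_cons hB
  have h₁ := charpoly_add_submatrix_mul_charpoly (reducedMatrix G₁ G₂) (reducedQuotient r₁ r₂)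
    blockConstants (vertexClass G₁ V₂) (reducedMatrix_block_row_sum hG₁ hG₂)
  rw [← eccentricityMatrix_centralVertexJoin htri hr₁ hG₁, reducedQuotient_add_blockConstants_mul,
    charpoly_reducedQuotient _ (Nat.cast_nonneg _)] at h₁
  have h₂ := charpoly_reducedMatrix (G₂ := G₂) hG₁
  rw [hL, hB, Multiset.map_cons, Multiset.map_cons, Multiset.prod_cons, Multiset.prod_cons] at h₂
  have hne : eigenvalueFactor r₁ r₁ * (X - C (-2 * (1 + (r₂ : ℝ)))) ≠ 0 :=
    mul_ne_zero (eigenvalueFactor_ne_zero _ _) (X_sub_C_ne_zero _)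
  refine mul_right_cancel₀ hne ?_
  linear_combination (X - C 3) ^ Fintype.card V₁ * h₁
    + (quotientMatrix (Fintype.card V₁) (Fintype.card G₁.edgeSet) r₁
        (Fintype.card V₂) r₂).charpoly * h₂

theorem eccSpectrum_centralVertexJoin_add_replicate (htri : G₁.CliqueFree 3) {r₁ r₂ : ℕ}
    (hr₁ : 1 ≤ r₁) (hG₁ : G₁.IsRegularOfDegree r₁) (hG₂ : G₂.IsRegularOfDegree r₂)
    {L B : Multiset ℝ} (hL : adjSpectrum G₁ = (r₁ : ℝ) ::ₘ L) (hB : adjSpectrum G₂ = (r₂ : ℝ) ::ₘ B) :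
    eccSpectrum (centralVertexJoin G₁ G₂) + Multiset.replicate (Fintype.card V₁) 3
      = Multiset.replicate (Fintype.card G₁.edgeSet) 3
        + remainingEigenvalues L B (Fintype.card V₁) (Fintype.card G₁.edgeSet) r₁
            (Fintype.card V₂) r₂ := by
  have key := congrArg roots
    (charpoly_eccentricityMatrix_centralVertexJoin htri hr₁ hG₁ hG₂ hL hB)
  have h3 : ∀ k, (X - C (3 : ℝ)) ^ k ≠ 0 := fun k => pow_ne_zero k (X_sub_C_ne_zero _)
  have hB' := prod_map_X_sub_C_ne_zero B fun β => -2 * (1 + β)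
  have hL₁ := prod_map_X_sub_C_ne_zero L fun l => -(2 * tValue 1 r₁ l + 3 * (l + r₁ - 1))
  have hL₂ := prod_map_X_sub_C_ne_zero L fun l => -(2 * tValue (-1) r₁ l + 3 * (l + r₁ - 1))
  unfold eigenvalueFactor at key
  rw [Multiset.prod_map_mul, roots_mul (mul_ne_zero (charpoly_monic _).ne_zero (h3 _)),
    roots_mul (mul_ne_zero (mul_ne_zero (mul_ne_zero (h3 _) (mul_ne_zero hL₁ hL₂)) hB')
      (charpoly_monic _).ne_zero),
    roots_mul (mul_ne_zero (mul_ne_zero (h3 _) (mul_ne_zero hL₁ hL₂)) hB'),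
    roots_mul (mul_ne_zero (h3 _) (mul_ne_zero hL₁ hL₂)), roots_mul (mul_ne_zero hL₁ hL₂),
    roots_prod_map_X_sub_C, roots_prod_map_X_sub_C, roots_prod_map_X_sub_C, roots_pow,
    roots_pow, roots_X_sub_C, Multiset.nsmul_singleton, Multiset.nsmul_singleton] at key
  rw [eccSpectrum, remainingEigenvalues, realEigenvalues, key, realEigenvalues]
  abel

end EccentricityOfJoin

end EccentricitySpectra

open EccentricitySpectra in
theorem theorem3p9 {V₁ V₂ : Type*}
    [Fintype V₁] [DecidableEq V₁] [Fintype V₂] [DecidableEq V₂]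
    (G₁ : SimpleGraph V₁) [DecidableRel G₁.Adj] (G₂ : SimpleGraph V₂) [DecidableRel G₂.Adj]
    (p₁ q₁ p₂ r₁ r₂ : ℕ)
    (hp₁ : Fintype.card V₁ = p₁) (hq₁ : G₁.edgeFinset.card = q₁) (hp₂ : Fintype.card V₂ = p₂)
    (htri : G₁.CliqueFree 3) (hr₁ : 1 ≤ r₁)
    (hG₁ : G₁.IsRegularOfDegree r₁) (hG₂ : G₂.IsRegularOfDegree r₂)
    (L B : Multiset ℝ)
    (hL : adjSpectrum G₁ = (r₁ : ℝ) ::ₘ L) (hB : adjSpectrum G₂ = (r₂ : ℝ) ::ₘ B) :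
    (p₁ ≤ q₁ →
      eccSpectrum (centralVertexJoin G₁ G₂)
        = Multiset.replicate (q₁ - p₁) 3 + remainingEigenvalues L B p₁ q₁ r₁ p₂ r₂) ∧
    (q₁ < p₁ →
      eccSpectrum (centralVertexJoin G₁ G₂) + Multiset.replicate (p₁ - q₁) 3
        = remainingEigenvalues L B p₁ q₁ r₁ p₂ r₂) := by
  subst hp₁ hp₂
  rw [SimpleGraph.edgeFinset_card] at hq₁
  subst hq₁
  -- Both cases follow from this identity by cancelling the copies of 3 common to the two sides.
  have key := eccSpectrum_centralVertexJoin_add_replicate htri hr₁ hG₁ hG₂ hL hB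
  refine ⟨fun h => ?_, fun h => ?_⟩
  · rw [show Multiset.replicate (Fintype.card G₁.edgeSet) (3 : ℝ)
        = Multiset.replicate (Fintype.card G₁.edgeSet - Fintype.card V₁) 3
          + Multiset.replicate (Fintype.card V₁) 3 by
        rw [← Multiset.replicate_add, Nat.sub_add_cancel h], add_right_comm] at key
    exact add_right_cancel key
  · rw [show Multiset.replicate (Fintype.card V₁) (3 : ℝ)
        = Multiset.replicate (Fintype.card V₁ - Fintype.card G₁.edgeSet) 3
          + Multiset.replicate (Fintype.card G₁.edgeSet) 3 by
        rw [← Multiset.replicate_add, Nat.sub_add_cancel h.le], ← add_assoc,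
      add_comm (Multiset.replicate (Fintype.card G₁.edgeSet) (3 : ℝ))] at key
    exact add_right_cancel key
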